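/- Let $h_1,\dots,h_k$ be local holomorphic diffeomorphisms of $\mathbb{C}^n$ fixing the origin (biholomorphic maps between open neighbourhoods of $0$ with $h_i(0)=0$). For an open neighbourhood $V$ of $0$ on which all the $h_i$ and $h_i^{-1}$ are defined and one-to-one, the pseudogroup generated by $h_1,\dots,h_k$ on $V$ consists of all finite compositions $g=F_s\circ\cdots\circ F_1$ with $F_j\in\{h_1^{\pm1},\dots,h_k^{\pm1}\}$, where the domain ${\rm Dom}_V(g)$ is the set of all $x\in V$ such that $F_l\circ\cdots\circ F_1(x)\in V$ for every $1\le l<s$ (the empty composition is the identity of $V$). The orbit of $p\in V$ is $\mathcal{O}_V(p)=\{q\in V : q=g(p) \text{ for some element } g \text{ of the pseudogroup with } p\in{\rm Dom}_V(g)\}$. The pseudogroup is said to have finite orbits on a neighbourhood of the origin if there is an open neighbourhood $V'$ of $0$, on which all the $h_i^{\pm1}$ are defined and one-to-one, such that $\mathcal{O}_{V'}(p)$ is finite for every $p\in V'$. Let $G$ be the subgroup generated by the germs at $0$ of $h_1,\dots,h_k$ in the group ${\rm Diff}(\mathbb{C}^n,0)$ of germs at $0$ of local holomorphic diffeomorphisms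 of $\mathbb{C}^n$ fixing $0$. **Theorem A.** Fix an open neighbourhood $V$ of $0$ on which all the $h_i^{\pm1}$ are defined and one-to-one, and suppose that for every element $g$ of the pseudogroup generated by $h_1,\dots,h_k$ on $V$ and every $p\in{\rm Dom}_V(g)$ with $g(p)=p$, either $p$ is an isolated fixed point of $g$ or $g$ coincides with the identity on a neighbourhood of $p$. Then the pseudogroup has finite orbits on a neighbourhood of the origin if and only if the group $G$ is finite. -/

import Mathlib

open Filter Topology

noncomputable section

namespace LocalDynamics

/-- A local holomorphic diffeomorphism of `ℂⁿ` fixing the origin: a biholomorphic map from an open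
neighbourhood `source` of `0` onto an open neighbourhood `target` of `0`, with `0 ↦ 0`. -/
structure LocalDiffeo (n : ℕ) extends OpenPartialHomeomorph (Fin n → ℂ) (Fin n → ℂ) where
  zero_mem_source : (0 : Fin n → ℂ) ∈ toOpenPartialHomeomorph.source
  map_zero' : toOpenPartialHomeomorph 0 = 0
  holomorphic : AnalyticOnNhd ℂ toOpenPartialHomeomorph toOpenPartialHomeomorph.source
  holomorphic_symm :
    AnalyticOnNhd ℂ toOpenPartialHomeomorph.symm toOpenPartialHomeomorph.target

namespace LocalDiffeo

variable {n : ℕ}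

/-- The identity of `ℂⁿ`. -/
def refl (n : ℕ) : LocalDiffeo n where
  toOpenPartialHomeomorph := OpenPartialHomeomorph.refl (Fin n → ℂ)
  zero_mem_source := Set.mem_univ _
  map_zero' := rfl
  holomorphic := analyticOnNhd_id
  holomorphic_symm := analyticOnNhd_id

theorem zero_mem_target (f : LocalDiffeo n) :
    (0 : Fin n → ℂ) ∈ f.toOpenPartialHomeomorph.target := by
  have h := f.toOpenPartialHomeomorph.map_source f.zero_mem_source
  rwa [f.map_zero'] at h

theorem symm_zero (f : LocalDiffeo n) : f.toOpenPartialHomeomorph.symm 0 = 0 := by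
  have h := f.toOpenPartialHomeomorph.left_inv f.zero_mem_source
  rwa [f.map_zero'] at h

/-- The inverse of a local diffeomorphism. -/
def symm (f : LocalDiffeo n) : LocalDiffeo n where
  toOpenPartialHomeomorph := f.toOpenPartialHomeomorph.symm
  zero_mem_source := f.zero_mem_target
  map_zero' := f.symm_zero
  holomorphic := f.holomorphic_symm
  holomorphic_symm := f.holomorphic

/-- The composition `f ∘ g`, defined where it makes sense. -/
def comp (f g : LocalDiffeo n) : LocalDiffeo n where
  toOpenPartialHomeomorph := g.toOpenPartialHomeomorph.trans f.toOpenPartialHomeomorph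
  zero_mem_source := by
    rw [OpenPartialHomeomorph.trans_source]
    refine ⟨g.zero_mem_source, ?_⟩
    rw [Set.mem_preimage, g.map_zero']
    exact f.zero_mem_source
  map_zero' := by
    rw [OpenPartialHomeomorph.trans_apply, g.map_zero', f.map_zero']
  holomorphic := by
    intro x hx
    rw [OpenPartialHomeomorph.trans_source] at hx
    rw [OpenPartialHomeomorph.coe_trans]
    exact (f.holomorphic _ hx.2).comp (g.holomorphic _ hx.1)
  holomorphic_symm := by
    intro x hx
    rw [OpenPartialHomeomorph.trans_target] at hx
    rw [OpenPartialHomeomorph.coe_trans_symm]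
    exact (g.holomorphic_symm _ hx.2).comp (f.holomorphic_symm _ hx.1)

theorem tendsto_zero (f : LocalDiffeo n) :
    Tendsto f.toOpenPartialHomeomorph (𝓝 0) (𝓝 0) := by
  have h := f.toOpenPartialHomeomorph.continuousAt f.zero_mem_source
  rwa [ContinuousAt, f.map_zero'] at h

/-- Two local diffeomorphisms have the same germ at the origin. -/
def germSetoid (n : ℕ) : Setoid (LocalDiffeo n) where
  r f g := ⇑f.toOpenPartialHomeomorph =ᶠ[𝓝 0] ⇑g.toOpenPartialHomeomorph
  iseqv := ⟨fun _ => EventuallyEq.rfl, fun h => h.symm, fun h h' => h.trans h'⟩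

theorem comp_congr {f f' g g' : LocalDiffeo n} (hf : germSetoid n f f')
    (hg : germSetoid n g g') : germSetoid n (f.comp g) (f'.comp g') := by
  change ∀ᶠ x in 𝓝 0, f.toOpenPartialHomeomorph (g.toOpenPartialHomeomorph x) =
    f'.toOpenPartialHomeomorph (g'.toOpenPartialHomeomorph x)
  filter_upwards [g.tendsto_zero.eventually hf, hg] with x h1 h2
  rw [h1, h2]

theorem symm_congr {f g : LocalDiffeo n} (h : germSetoid n f g) :
    germSetoid n f.symm g.symm := by
  change ∀ᶠ y in 𝓝 0, f.toOpenPartialHomeomorph.symm y = g.toOpenPartialHomeomorph.symm y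
  have ht : Tendsto f.toOpenPartialHomeomorph.symm (𝓝 0) (𝓝 0) := f.symm.tendsto_zero
  filter_upwards [ht.eventually h, f.toOpenPartialHomeomorph.open_target.mem_nhds
    f.zero_mem_target, ht.eventually (g.toOpenPartialHomeomorph.open_source.mem_nhds
    g.zero_mem_source)] with y h1 h2 h3
  rw [f.toOpenPartialHomeomorph.right_inv h2] at h1
  conv_rhs => rw [h1]
  exact (g.toOpenPartialHomeomorph.left_inv h3).symm

end LocalDiffeo

/-- `Diff(ℂⁿ, 0)`: the germs at the origin of local holomorphic diffeomorphisms of `ℂⁿ` fixing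
the origin. -/
def Diff (n : ℕ) : Type := Quotient (LocalDiffeo.germSetoid n)

/-- The germ at the origin of a local diffeomorphism. -/
def LocalDiffeo.germ {n : ℕ} (f : LocalDiffeo n) : Diff n :=
  Quotient.mk (LocalDiffeo.germSetoid n) f

/-- `Diff(ℂⁿ, 0)` is a group under composition of germs. -/
instance Diff.instGroup (n : ℕ) : Group (Diff n) where
  mul := Quotient.map₂ LocalDiffeo.comp fun _ _ hf _ _ hg => LocalDiffeo.comp_congr hf hg
  one := (LocalDiffeo.refl n).germ
  inv := Quotient.map LocalDiffeo.symm fun _ _ h => LocalDiffeo.symm_congr h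
  mul_assoc := by
    rintro ⟨f⟩ ⟨g⟩ ⟨h⟩
    exact Quotient.sound (s := LocalDiffeo.germSetoid n) EventuallyEq.rfl
  one_mul := by
    rintro ⟨f⟩
    exact Quotient.sound (s := LocalDiffeo.germSetoid n) EventuallyEq.rfl
  mul_one := by
    rintro ⟨f⟩
    exact Quotient.sound (s := LocalDiffeo.germSetoid n) EventuallyEq.rfl
  inv_mul_cancel := by
    rintro ⟨f⟩
    refine Quotient.sound (s := LocalDiffeo.germSetoid n) ?_
    filter_upwards [f.toOpenPartialHomeomorph.open_source.mem_nhds f.zero_mem_source] with x hx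
    exact f.toOpenPartialHomeomorph.left_inv hx

variable {n k : ℕ}

/-- `V` is an open neighbourhood of the origin on which all the generators `h i` and their inverses
are defined (they are then one-to-one on `V`). -/
def IsAdmissible (h : Fin k → LocalDiffeo n) (V : Set (Fin n → ℂ)) : Prop :=
  IsOpen V ∧ 0 ∈ V ∧ ∀ i, V ⊆ (h i).toOpenPartialHomeomorph.source ∧
    V ⊆ (h i).toOpenPartialHomeomorph.target

/-- The letter `(i, true)` stands for `h i`, the letter `(i, false)` for its inverse. -/
def letter (h : Fin k → LocalDiffeo n) (a : Fin k × Bool) : LocalDiffeo n :=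
  if a.2 then h a.1 else (h a.1).symm

/-- The map `F_s ∘ ⋯ ∘ F_1` attached to the word `[F_1, …, F_s]` in the generators and their
inverses. It is only meaningful on the domain `wordDom h V w` below. -/
def wordMap (h : Fin k → LocalDiffeo n) : List (Fin k × Bool) → (Fin n → ℂ) → (Fin n → ℂ)
  | [], x => x
  | a :: w, x => wordMap h w ((letter h a).toOpenPartialHomeomorph x)

/-- The domain of `F_s ∘ ⋯ ∘ F_1` as an element of the pseudogroup generated by `h` on `V`: the
points `x ∈ V` such that `F_l ∘ ⋯ ∘ F_1 (x) ∈ V` for all `1 ≤ l < s`. -/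
def wordDom (h : Fin k → LocalDiffeo n) (V : Set (Fin n → ℂ)) (w : List (Fin k × Bool)) :
    Set (Fin n → ℂ) :=
  {x | x ∈ V ∧ ∀ l, 1 ≤ l → l < w.length → wordMap h (w.take l) x ∈ V}

/-- The orbit of `p` under the pseudogroup generated by `h` on `V`: the points `q ∈ V` of the form
`q = F(p)`, with `F` in the pseudogroup and `p` in the domain of `F`. -/
def orbit (h : Fin k → LocalDiffeo n) (V : Set (Fin n → ℂ)) (p : Fin n → ℂ) :
    Set (Fin n → ℂ) :=
  {q | q ∈ V ∧ ∃ w, p ∈ wordDom h V w ∧ q = wordMap h w p}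

/-- The pseudogroup generated by `h` has finite orbits (on some neighbourhood of the origin). -/
def HasFiniteOrbits (h : Fin k → LocalDiffeo n) : Prop :=
  ∃ V, IsAdmissible h V ∧ ∀ p ∈ V, (orbit h V p).Finite

/-- `p` is an isolated fixed point of `g` (for `p` with `g p = p`): no other point near `p`
is fixed by `g`. -/
def IsIsolatedFixedPoint (g : (Fin n → ℂ) → (Fin n → ℂ)) (p : Fin n → ℂ) : Prop :=
  g p = p ∧ ∀ᶠ x in 𝓝[≠] p, g x ≠ x

/-- Every fixed point of every element of the pseudogroup generated by `h` on `V` is isolated, unless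
that element is the identity near that point. -/
def FixedPointsIsolatedOrTrivial (h : Fin k → LocalDiffeo n) (V : Set (Fin n → ℂ)) : Prop :=
  ∀ w, ∀ p ∈ wordDom h V w, wordMap h w p = p →
    IsIsolatedFixedPoint (wordMap h w) p ∨ ∀ᶠ x in 𝓝 p, wordMap h w x = x

/-- The subgroup of `Diff(ℂⁿ, 0)` generated by the germs of the `h i`. -/
def germGroup (h : Fin k → LocalDiffeo n) : Subgroup (Diff n) :=
  Subgroup.closure (Set.range fun i => (h i).germ)

end LocalDynamics

end

/- Fix a closed ball `S ⊆ V` with interior `U`, and count the germs at `x` of the words along which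
`x` stays in `S`, respectively in `U`. The first count is upper semicontinuous in `x`; the second is
lower semicontinuous by the identity theorem; both are constant along words. If the first count is
finite on the sphere `S \ U`, it is bounded there by some `N`, and at a point where it exceeds `N`
no admissible word meets the sphere, so that the two counts agree. Hence `{count ≤ N}` is clopen in
`S` and the count is finite at `0`, where it is the order of the germ group.

At a point with finite orbit and infinitely many germs, two words with distinct germs take the same
value, so the point is an isolated fixed point of some word. There are only countably many of those,
and some sphere avoids them all. Conversely, if the germ group is finite, upper semicontinuity
bounds the orbits near `0`. -/

noncomputable section

namespace LocalDynamics

section Topology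

theorem countable_setOf_isolated {X : Type*} [TopologicalSpace X] [HereditarilyLindelofSpace X]
    (s : Set X) : {x ∈ s | ∀ᶠ y in 𝓝[≠] x, y ∉ s}.Countable := by
  have : DiscreteTopology {x ∈ s | ∀ᶠ y in 𝓝[≠] x, y ∉ s} := by
    rw [discreteTopology_subtype_iff]
    intro x hx
    rw [inf_principal_eq_bot]
    filter_upwards [hx.2] with y hys hy
    exact hys hy.1
  exact countable_of_Lindelof_of_discrete (X := {x ∈ s | ∀ᶠ y in 𝓝[≠] x, y ∉ s})

theorem exists_disjoint_sphere_of_countable {X : Type*} [PseudoMetricSpace X] {C : Set X}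
    (hC : C.Countable) (x : X) {a b : ℝ} (hab : a < b) :
    ∃ r ∈ Set.Ioo a b, Disjoint (Metric.sphere x r) C := by
  obtain ⟨r, hr, hrab⟩ := ((hC.image (dist · x)).dense_compl ℝ).exists_between hab
  exact ⟨r, hrab, Set.disjoint_left.2 fun y hy hyC => hr ⟨y, hyC, hy⟩⟩

theorem forall_le_of_isPreconnected {X α : Type*} [TopologicalSpace X] [LinearOrder α]
    {f g : X → α} {c c' : α} {K : Set X} (hK : IsPreconnected K) (hc : c ⋖ c')
    (hf : UpperSemicontinuous f) (hg : LowerSemicontinuous g) (hgf : ∀ x ∈ K, g x ≤ f x)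
    (hfg : ∀ x ∈ K, c < f x → c < g x) (hle : ∃ x ∈ K, f x ≤ c) : ∀ x ∈ K, f x ≤ c := by
  have hlt : ∀ {a}, a < c' ↔ a ≤ c := covBy_iff_lt_iff_le_left.1 hc
  by_contra! hgt
  obtain ⟨x, hxK, hx⟩ := hgt
  obtain ⟨y, hyK, hy⟩ := hle
  obtain ⟨z, hzK, hzf, hzg⟩ := hK _ _ (hf.isOpen_preimage c') (hg.isOpen_preimage c)
    (fun z hz => (le_or_gt (f z) c).imp hlt.2 (hfg z hz)) ⟨y, hyK, hlt.2 hy⟩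
    ⟨x, hxK, hfg x hxK hx⟩
  exact (hzg.trans_le (hgf z hzK)).not_ge (hlt.1 hzf)

theorem eventuallyEq_of_symm_comp_eventuallyEq_id {X Y : Type*} [TopologicalSpace X]
    [TopologicalSpace Y] (e : OpenPartialHomeomorph X Y) {f : X → Y} {x : X} (hx : x ∈ e.source)
    (hf : ContinuousAt f x) (hfx : f x = e x) (hid : e.symm ∘ f =ᶠ[𝓝 x] id) : f =ᶠ[𝓝 x] e := by
  have htarget : ∀ᶠ y in 𝓝 x, f y ∈ e.target :=
    hf.eventually_mem (e.open_target.mem_nhds (hfx ▸ e.map_source hx))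
  filter_upwards [hid, htarget] with y hy hyt
  rw [← e.right_inv hyt]
  exact congrArg e hy

end Topology

section Analytic

variable {𝕜 E F : Type*} [NontriviallyNormedField 𝕜] [NormedAddCommGroup E] [NormedSpace 𝕜 E]
  [LocallyConnectedSpace E] [NormedAddCommGroup F] [NormedSpace 𝕜 F] [CompleteSpace F]

theorem eventually_not_eventuallyEq_of_analyticAt {f g : E → F} {x : E} (hf : AnalyticAt 𝕜 f x)
    (hg : AnalyticAt 𝕜 g x) (hfg : ¬ f =ᶠ[𝓝 x] g) : ∀ᶠ y in 𝓝 x, ¬ f =ᶠ[𝓝 y] g := by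
  obtain ⟨U, ⟨hUx, hU⟩, hUfg⟩ := (locallyConnectedSpace_iff_connected_basis.1 ‹_› x).mem_iff.1
    (hf.eventually_analyticAt.and hg.eventually_analyticAt)
  filter_upwards [hUx] with y hy hyfg
  have heqOn : Set.EqOn f g U := AnalyticOnNhd.eqOn_of_preconnected_of_eventuallyEq
    (fun z hz => (hUfg hz).1) (fun z hz => (hUfg hz).2) hU hy hyfg
  exact hfg (heqOn.eventuallyEq_of_mem hUx)

theorem eventually_injOn_germ {ι : Type*} {f : ι → E → F} {T : Set ι} (hT : T.Finite) {x : E}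
    (hf : ∀ i ∈ T, AnalyticAt 𝕜 (f i) x) (hinj : Set.InjOn (fun i => (f i : Germ (𝓝 x) F)) T) :
    ∀ᶠ y in 𝓝 x, Set.InjOn (fun i => (f i : Germ (𝓝 y) F)) T := by
  refine (eventually_all_finite hT).2 fun i hi => ?_
  suffices ∀ᶠ y in 𝓝 x, ∀ j ∈ T, (f i : Germ (𝓝 y) F) = f j → i = j from
    this.mono fun _ hy _ => hy _
  refine (eventually_all_finite hT).2 fun j hj => ?_
  by_cases hij : i = j
  · exact Eventually.of_forall fun _ _ => hij
  · have hne : ¬ f i =ᶠ[𝓝 x] f j := fun heq => hij (hinj hi hj (Germ.coe_eq.2 heq))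
    filter_upwards [eventually_not_eventuallyEq_of_analyticAt (hf i hi) (hf j hj) hne] with y hy heq
    exact absurd (Germ.coe_eq.1 heq) hy

end Analytic

variable {n k : ℕ} {h : Fin k → LocalDiffeo n} {S U V : Set (Fin n → ℂ)}
  {u v w : List (Fin k × Bool)} {x : Fin n → ℂ}

section Words

theorem letter_flip (a : Fin k × Bool) : letter h (a.1, !a.2) = (letter h a).symm := by
  obtain ⟨i, _ | _⟩ := a <;> rfl

theorem IsAdmissible.subset_letter_source (hV : IsAdmissible h V) (a : Fin k × Bool) :
    V ⊆ (letter h a).toOpenPartialHomeomorph.source := by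
  obtain ⟨i, _ | _⟩ := a
  · exact (hV.2.2 i).2
  · exact (hV.2.2 i).1

theorem IsAdmissible.mono (hV : IsAdmissible h V) (hUV : U ⊆ V) (hU : IsOpen U) (h0 : 0 ∈ U) :
    IsAdmissible h U :=
  ⟨hU, h0, fun i => ⟨hUV.trans (hV.2.2 i).1, hUV.trans (hV.2.2 i).2⟩⟩

theorem wordMap_append (u v : List (Fin k × Bool)) :
    wordMap h (u ++ v) = wordMap h v ∘ wordMap h u := by
  induction u with
  | nil => rfl
  | cons a u ih => exact congrArg (· ∘ (letter h a).toOpenPartialHomeomorph) ih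

theorem wordMap_zero (w : List (Fin k × Bool)) : wordMap h w 0 = 0 := by
  induction w with
  | nil => rfl
  | cons a w ih => rwa [wordMap, (letter h a).map_zero']

/-- The composition of the letters of a word as a local diffeomorphism, on the largest domain on
which it makes sense. -/
def wordDiffeo (h : Fin k → LocalDiffeo n) : List (Fin k × Bool) → LocalDiffeo n
  | [] => LocalDiffeo.refl n
  | a :: w => (wordDiffeo h w).comp (letter h a)

theorem coe_wordDiffeo (w : List (Fin k × Bool)) :
    ⇑(wordDiffeo h w).toOpenPartialHomeomorph = wordMap h w := by
  induction w with
  | nil => rfl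
  | cons a w ih => exact congrArg (· ∘ (letter h a).toOpenPartialHomeomorph) ih

theorem coe_wordDiffeo_symm (w : List (Fin k × Bool)) :
    ⇑(wordDiffeo h w).toOpenPartialHomeomorph.symm = wordMap h (FreeGroup.invRev w) := by
  induction w with
  | nil => rfl
  | cons a w ih =>
    rw [FreeGroup.invRev_cons, wordMap_append, ← ih]
    change _ = ⇑(letter h (a.1, !a.2)).toOpenPartialHomeomorph ∘ _
    rw [letter_flip]
    rfl

end Words

section Stays

/-- The point `x` and all its images under the initial segments of the word `w`, including `w`
itself, lie in `S`. Unlike in `wordDom`, the end point is required to lie in `S` as well. -/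
def Stays (h : Fin k → LocalDiffeo n) (S : Set (Fin n → ℂ)) (w : List (Fin k × Bool))
    (x : Fin n → ℂ) : Prop :=
  ∀ l, wordMap h (w.take l) x ∈ S

theorem stays_iff_mem_wordDom : Stays h S w x ↔ x ∈ wordDom h S w ∧ wordMap h w x ∈ S := by
  refine ⟨fun hw => ⟨⟨hw 0, fun l _ _ => hw l⟩, w.take_length ▸ hw w.length⟩, ?_⟩
  rintro ⟨⟨hx, hpre⟩, hwx⟩ l
  rcases Nat.eq_zero_or_pos l with rfl | hl
  · exact hx
  rcases lt_or_ge l w.length with hlw | hlw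
  · exact hpre l hl hlw
  · rwa [List.take_of_length_le hlw]

theorem stays_nil : Stays h S [] x ↔ x ∈ S :=
  ⟨fun hx => hx 0, fun hx l => by rwa [List.take_nil]⟩

theorem stays_cons {a : Fin k × Bool} :
    Stays h S (a :: w) x ↔ x ∈ S ∧ Stays h S w ((letter h a).toOpenPartialHomeomorph x) :=
  ⟨fun hw => ⟨hw 0, fun l => hw (l + 1)⟩, fun hw l => l.casesOn hw.1 hw.2⟩

theorem stays_zero (h0 : 0 ∈ S) (w : List (Fin k × Bool)) : Stays h S w 0 :=
  fun l => (wordMap_zero (w.take l)).symm ▸ h0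

namespace Stays

theorem mem (hw : Stays h S w x) : x ∈ S :=
  hw 0

theorem map_mem (hw : Stays h S w x) : wordMap h w x ∈ S :=
  (stays_iff_mem_wordDom.1 hw).2

theorem mono (hUS : U ⊆ S) (hw : Stays h U w x) : Stays h S w x :=
  fun l => hUS (hw l)

end Stays

theorem stays_append :
    Stays h S (u ++ v) x ↔ Stays h S u x ∧ Stays h S v (wordMap h u x) := by
  induction u generalizing x with
  | nil => exact ⟨fun hv => ⟨stays_nil.2 hv.mem, hv⟩, fun hv => hv.2⟩
  | cons a u ih => rw [List.cons_append, stays_cons, stays_cons, ih, and_assoc, wordMap]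

theorem stays_append_singleton {a : Fin k × Bool} :
    Stays h S (u ++ [a]) x ↔ Stays h S u x ∧ wordMap h (u ++ [a]) x ∈ S := by
  rw [stays_append, stays_cons, stays_nil, wordMap_append]
  exact and_congr_right fun hu => and_iff_right hu.map_mem

namespace Stays

theorem take (hw : Stays h S w x) (l : ℕ) : Stays h S (w.take l) x := by
  rw [← List.take_append_drop l w, stays_append] at hw
  exact hw.1

theorem mem_source (hV : IsAdmissible h V) (hw : Stays h V w x) :
    x ∈ (wordDiffeo h w).toOpenPartialHomeomorph.source := by
  induction w generalizing x with
  | nil => exact Set.mem_univ x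
  | cons a w ih =>
    rw [stays_cons] at hw
    exact ⟨hV.subset_letter_source a hw.1, ih hw.2⟩

theorem analyticAt (hV : IsAdmissible h V) (hw : Stays h V w x) : AnalyticAt ℂ (wordMap h w) x := by
  rw [← coe_wordDiffeo]
  exact (wordDiffeo h w).holomorphic x (hw.mem_source hV)

theorem continuousAt_append_singleton (hV : IsAdmissible h V) (hw : Stays h V w x)
    (a : Fin k × Bool) : ContinuousAt (wordMap h (w ++ [a])) x := by
  have hletter : ContinuousAt (letter h a).toOpenPartialHomeomorph (wordMap h w x) :=
    (letter h a).toOpenPartialHomeomorph.continuousAt (hV.subset_letter_source a hw.map_mem)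
  rw [wordMap_append]
  exact hletter.comp (hw.analyticAt hV).continuousAt

theorem map_nhds_eq (hV : IsAdmissible h V) (hw : Stays h V w x) :
    map (wordMap h w) (𝓝 x) = 𝓝 (wordMap h w x) := by
  rw [← coe_wordDiffeo]
  exact (wordDiffeo h w).toOpenPartialHomeomorph.map_nhds_eq (hw.mem_source hV)

theorem eventually_nhds (hV : IsAdmissible h V) (hUV : U ⊆ V) (hU : IsOpen U)
    (hw : Stays h U w x) : ∀ᶠ y in 𝓝 x, Stays h U w y := by
  have hfinite : ∀ᶠ y in 𝓝 x, ∀ l ∈ Set.Iic w.length, wordMap h (w.take l) y ∈ U :=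
    (eventually_all_finite (Set.finite_Iic _)).2 fun l _ =>
      (((hw.take l).mono hUV).analyticAt hV).continuousAt.eventually_mem (hU.mem_nhds (hw l))
  filter_upwards [hfinite] with y hy l
  rw [List.take_eq_take_min]
  exact hy _ (min_le_right l _)

theorem wordMap_invRev (hV : IsAdmissible h V) (hw : Stays h V w x) :
    wordMap h (FreeGroup.invRev w) (wordMap h w x) = x := by
  rw [← coe_wordDiffeo_symm, ← coe_wordDiffeo]
  exact (wordDiffeo h w).toOpenPartialHomeomorph.left_inv (hw.mem_source hV)

theorem invRev (hV : IsAdmissible h V) (hSV : S ⊆ V) (hw : Stays h S w x) :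
    Stays h S (FreeGroup.invRev w) (wordMap h w x) := by
  induction w generalizing x with
  | nil => exact hw
  | cons a w ih =>
    have hback := (hw.mono hSV).wordMap_invRev hV
    rw [FreeGroup.invRev_cons] at hback ⊢
    exact stays_append_singleton.2 ⟨ih (stays_cons.1 hw).2, hback.symm ▸ hw.mem⟩

end Stays

end Stays

section Germs

/-- The germ at `x` of the map attached to the word `w`. -/
def wordGerm (h : Fin k → LocalDiffeo n) (x : Fin n → ℂ) (w : List (Fin k × Bool)) :
    Germ (𝓝 x) (Fin n → ℂ) :=
  (wordMap h w : Germ (𝓝 x) (Fin n → ℂ))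

theorem wordGerm_eq_iff : wordGerm h x u = wordGerm h x v ↔ wordMap h u =ᶠ[𝓝 x] wordMap h v :=
  Germ.coe_eq

theorem wordGerm_append_congr (huv : wordGerm h x u = wordGerm h x v) (w : List (Fin k × Bool)) :
    wordGerm h x (u ++ w) = wordGerm h x (v ++ w) := by
  rw [wordGerm_eq_iff, wordMap_append, wordMap_append]
  exact (wordGerm_eq_iff.1 huv).fun_comp (wordMap h w)

theorem wordGerm_append_left_cancel (hV : IsAdmissible h V) (hw : Stays h V w x)
    (huv : wordGerm h x (w ++ u) = wordGerm h x (w ++ v)) :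
    wordGerm h (wordMap h w x) u = wordGerm h (wordMap h w x) v := by
  rw [wordGerm_eq_iff, wordMap_append, wordMap_append] at huv
  rw [wordGerm_eq_iff, ← hw.map_nhds_eq hV]
  exact huv

theorem wordGerm_eq_of_append_invRev (hV : IsAdmissible h V) (hu : Stays h V u x)
    (hv : Stays h V v x) (huv : wordMap h u x = wordMap h v x)
    (hid : wordMap h (u ++ FreeGroup.invRev v) =ᶠ[𝓝 x] id) : wordGerm h x u = wordGerm h x v := by
  rw [wordMap_append, ← coe_wordDiffeo_symm] at hid
  rw [wordGerm_eq_iff, ← coe_wordDiffeo v]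
  exact eventuallyEq_of_symm_comp_eventuallyEq_id _ (hv.mem_source hV)
    (hu.analyticAt hV).continuousAt (by rw [huv, coe_wordDiffeo]) hid

/-- The germs at `x` of the words along which `x` stays in `S`. -/
def germsAt (h : Fin k → LocalDiffeo n) (S : Set (Fin n → ℂ)) (x : Fin n → ℂ) :
    Set (Germ (𝓝 x) (Fin n → ℂ)) :=
  wordGerm h x '' {w | Stays h S w x}

theorem germsAt_mono (hUS : U ⊆ S) (x : Fin n → ℂ) : germsAt h U x ⊆ germsAt h S x :=
  Set.image_mono fun _ hw => hw.mono hUS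

theorem germsAt_zero (h0 : 0 ∈ S) : germsAt h S 0 = Set.range (wordGerm h 0) := by
  rw [germsAt, Set.eq_univ_of_forall (s := {w | Stays h S w 0}) (stays_zero h0), Set.image_univ]

theorem orbit_eq_image_germsAt (h : Fin k → LocalDiffeo n) (V : Set (Fin n → ℂ))
    (p : Fin n → ℂ) : orbit h V p = Germ.value '' germsAt h V p := by
  ext q
  constructor
  · rintro ⟨hq, w, hw, rfl⟩
    exact ⟨wordGerm h p w, ⟨w, stays_iff_mem_wordDom.2 ⟨hw, hq⟩, rfl⟩, rfl⟩
  · rintro ⟨_, ⟨w, hw, rfl⟩, rfl⟩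
    exact ⟨hw.map_mem, w, (stays_iff_mem_wordDom.1 hw).1, rfl⟩

/-- The germ of functions underlying an element of `Diff(ℂⁿ, 0)`. -/
def Diff.toGerm : Diff n → Germ (𝓝 (0 : Fin n → ℂ)) (Fin n → ℂ) :=
  Quotient.lift (s := LocalDiffeo.germSetoid n)
    (fun f => (⇑f.toOpenPartialHomeomorph : Germ (𝓝 (0 : Fin n → ℂ)) (Fin n → ℂ)))
    fun _ _ hfg => Germ.coe_eq.2 hfg

theorem Diff.toGerm_injective : Function.Injective (Diff.toGerm (n := n)) := by
  rintro ⟨f⟩ ⟨g⟩ hfg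
  exact Quotient.sound (s := LocalDiffeo.germSetoid n) (Germ.coe_eq.1 hfg)

theorem Diff.toGerm_germ_wordDiffeo (w : List (Fin k × Bool)) :
    Diff.toGerm (wordDiffeo h w).germ = wordGerm h 0 w :=
  congrArg Germ.ofFun (coe_wordDiffeo w)

theorem germ_letter (a : Fin k × Bool) :
    (letter h a).germ = FreeGroup.lift (fun i => (h i).germ) (FreeGroup.mk [a]) := by
  obtain ⟨i, _ | _⟩ := a <;> exact (List.prod_singleton).symm

/- Words act from the left to the right, while products in `Diff n` are compositions: hence the
reversal. -/
theorem germ_wordDiffeo (w : List (Fin k × Bool)) :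
    (wordDiffeo h w).germ = FreeGroup.lift (fun i => (h i).germ) (FreeGroup.mk w.reverse) := by
  induction w with
  | nil => exact (map_one (FreeGroup.lift fun i => (h i).germ)).symm
  | cons a w ih =>
    rw [List.reverse_cons, ← FreeGroup.mul_mk, map_mul, ← ih, ← germ_letter]
    rfl

theorem coe_germGroup :
    (germGroup h : Set (Diff n)) = Set.range fun w => (wordDiffeo h w).germ := by
  have hsurj : Function.Surjective fun w : List (Fin k × Bool) => FreeGroup.mk w.reverse :=
    Quot.mk_surjective.comp List.reverse_surjective
  simp only [germGroup, ← FreeGroup.range_lift_eq_closure, MonoidHom.coe_range, germ_wordDiffeo]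
  exact (hsurj.range_comp _).symm

theorem finite_germGroup_iff (h0 : 0 ∈ S) :
    Finite (germGroup h) ↔ (germsAt h S 0).Finite := by
  have himage : Diff.toGerm '' (germGroup h : Set (Diff n)) = germsAt h S 0 := by
    rw [coe_germGroup, ← Set.range_comp, germsAt_zero h0]
    exact congrArg Set.range (funext Diff.toGerm_germ_wordDiffeo)
  rw [← himage, Set.finite_image_iff Diff.toGerm_injective.injOn]
  exact Iff.rfl

end Germs

section GermCount

/-- The number of germs at `x` of the words along which `x` stays in `S`. -/
def germCount (h : Fin k → LocalDiffeo n) (S : Set (Fin n → ℂ)) (x : Fin n → ℂ) : ℕ∞ :=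
  (germsAt h S x).encard

theorem germCount_lt_top_iff : germCount h S x < ⊤ ↔ (germsAt h S x).Finite :=
  Set.encard_lt_top_iff

theorem germCount_wordMap_le (hV : IsAdmissible h V) (hSV : S ⊆ V) (hw : Stays h S w x) :
    germCount h S (wordMap h w x) ≤ germCount h S x := by
  have hwV : Stays h V w x := hw.mono hSV
  refine Set.encard_le_encard_of_injOn
    (f := fun γ => γ.compTendsto (wordMap h w) (hwV.analyticAt hV).continuousAt) ?_ ?_
  · rintro _ ⟨u, hu, rfl⟩
    exact ⟨w ++ u, stays_append.2 ⟨hw, hu⟩, congrArg Germ.ofFun (wordMap_append w u)⟩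
  · rintro _ ⟨u, -, rfl⟩ _ ⟨v, -, rfl⟩ huv
    refine wordGerm_append_left_cancel hV hwV ?_
    rw [wordGerm, wordGerm, wordMap_append, wordMap_append]
    exact huv

theorem germCount_wordMap (hV : IsAdmissible h V) (hSV : S ⊆ V) (hw : Stays h S w x) :
    germCount h S (wordMap h w x) = germCount h S x := by
  refine (germCount_wordMap_le hV hSV hw).antisymm ?_
  have hle := germCount_wordMap_le hV hSV (hw.invRev hV hSV)
  rwa [(hw.mono hSV).wordMap_invRev hV] at hle

theorem exists_bijOn_wordGerm {G : Set (Germ (𝓝 x) (Fin n → ℂ))} (hG : G ⊆ germsAt h S x)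
    (hfin : G.Finite) : ∃ T : Set (List (Fin k × Bool)), T.Finite ∧ T.encard = G.encard ∧
      (∀ w ∈ T, Stays h S w x) ∧ Set.BijOn (wordGerm h x) T G := by
  obtain ⟨T, hTS, hT⟩ := Set.SurjOn.exists_bijOn_subset hG
  exact ⟨T, hT.finite_iff_finite.2 hfin, by rw [← hT.image_eq, hT.injOn.encard_image], hTS, hT⟩

theorem germsAt_subset_of_append_singleton {T : Set (List (Fin k × Bool))}
    (hnil : x ∈ S → wordGerm h x [] ∈ wordGerm h x '' T)
    (happend : ∀ w ∈ T, ∀ a, wordMap h (w ++ [a]) x ∈ S →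
      wordGerm h x (w ++ [a]) ∈ wordGerm h x '' T) :
    germsAt h S x ⊆ wordGerm h x '' T := by
  rintro _ ⟨u, hu, rfl⟩
  induction u using List.reverseRecOn with
  | nil => exact hnil (Stays.mem hu)
  | append_singleton u a ih =>
    obtain ⟨hu, hua⟩ := stays_append_singleton.1 hu
    obtain ⟨w, hwT, hwu⟩ := ih hu
    have hwua : wordGerm h x (w ++ [a]) = wordGerm h x (u ++ [a]) := wordGerm_append_congr hwu [a]
    rw [← (wordGerm_eq_iff.1 hwua).eq_of_nhds] at hua
    exact hwua ▸ happend w hwT a hua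

theorem eventually_wordGerm_mem_image (hS : IsClosed S) {T : Set (List (Fin k × Bool))}
    (hu : ContinuousAt (wordMap h u) x)
    (hmem : wordMap h u x ∈ S → wordGerm h x u ∈ wordGerm h x '' T) :
    ∀ᶠ y in 𝓝 x, wordMap h u y ∈ S → wordGerm h y u ∈ wordGerm h y '' T := by
  by_cases hux : wordMap h u x ∈ S
  · obtain ⟨w, hwT, hwu⟩ := hmem hux
    filter_upwards [(wordGerm_eq_iff.1 hwu).eventuallyEq_nhds] with y hy _
    exact ⟨w, hwT, wordGerm_eq_iff.2 hy⟩
  · filter_upwards [hu.eventually_mem (hS.isOpen_compl.mem_nhds hux)] with y hy hyS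
    exact absurd hyS hy

theorem upperSemicontinuous_germCount (hV : IsAdmissible h V) (hSV : S ⊆ V) (hS : IsClosed S) :
    UpperSemicontinuous (germCount h S) := by
  intro x c hc
  obtain ⟨T, hTfin, hTcard, hTS, hT⟩ := exists_bijOn_wordGerm subset_rfl
    (germCount_lt_top_iff.1 (hc.trans_le le_top))
  have hmem : ∀ u, Stays h S u x → wordGerm h x u ∈ wordGerm h x '' T := fun u hu =>
    hT.surjOn ⟨u, hu, rfl⟩
  have hid : ContinuousAt (wordMap h []) x := continuousAt_id
  have hnil : ∀ᶠ y in 𝓝 x, y ∈ S → wordGerm h y [] ∈ wordGerm h y '' T :=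
    eventually_wordGerm_mem_image hS hid fun hx => hmem [] (stays_nil.2 hx)
  have happend : ∀ᶠ y in 𝓝 x, ∀ w ∈ T, ∀ a, wordMap h (w ++ [a]) y ∈ S →
      wordGerm h y (w ++ [a]) ∈ wordGerm h y '' T :=
    (eventually_all_finite hTfin).2 fun w hw => eventually_all.2 fun a =>
      eventually_wordGerm_mem_image hS (((hTS w hw).mono hSV).continuousAt_append_singleton hV a)
        fun hwa => hmem _ (stays_append_singleton.2 ⟨hTS w hw, hwa⟩)
  filter_upwards [hnil, happend] with y hynil hyappend
  calc germCount h S y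
      ≤ (wordGerm h y '' T).encard :=
        Set.encard_le_encard (germsAt_subset_of_append_singleton hynil hyappend)
    _ ≤ T.encard := Set.encard_image_le _ T
    _ = germCount h S x := hTcard
    _ < c := hc

theorem lowerSemicontinuous_germCount (hV : IsAdmissible h V) (hUV : U ⊆ V) (hU : IsOpen U) :
    LowerSemicontinuous (germCount h U) := by
  intro x c hc
  obtain ⟨G, hG, hGcard⟩ := Set.exists_subset_encard_eq (Order.add_one_le_of_lt hc)
  have hGfin : G.Finite := Set.encard_ne_top_iff.1 <| hGcard.trans_ne <|
    WithTop.add_ne_top.2 ⟨hc.ne_top, ENat.one_ne_top⟩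
  obtain ⟨T, hTfin, hTcard, hTU, hT⟩ := exists_bijOn_wordGerm hG hGfin
  have hstays : ∀ᶠ y in 𝓝 x, ∀ w ∈ T, Stays h U w y :=
    (eventually_all_finite hTfin).2 fun w hw => (hTU w hw).eventually_nhds hV hUV hU
  have hinj : ∀ᶠ y in 𝓝 x, Set.InjOn (wordGerm h y) T :=
    eventually_injOn_germ hTfin (fun w hw => ((hTU w hw).mono hUV).analyticAt hV) hT.injOn
  filter_upwards [hstays, hinj] with y hystays hyinj
  calc c < c + 1 := (ENat.lt_add_one_iff hc.ne_top).2 le_rfl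
    _ = T.encard := (hTcard.trans hGcard).symm
    _ = (wordGerm h y '' T).encard := hyinj.encard_image.symm
    _ ≤ germCount h U y := Set.encard_le_encard (Set.image_mono hystays)

/- A word along which `x` stays in `S` cannot visit a point of `S \ U`, since the germ count is the
same at that point as at `x`. -/
theorem germsAt_eq_of_lt_germCount (hV : IsAdmissible h V) (hSV : S ⊆ V) (hUS : U ⊆ S) {N : ℕ∞}
    (hN : ∀ y ∈ S \ U, germCount h S y ≤ N) (hx : N < germCount h S x) :
    germsAt h S x = germsAt h U x := by
  refine (Set.image_mono fun w hw l => ?_).antisymm (germsAt_mono hUS x)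
  by_contra hlU
  have hle := hN _ ⟨hw l, hlU⟩
  rw [germCount_wordMap hV hSV (Stays.take hw l)] at hle
  exact hx.not_ge hle

theorem finite_germsAt_of_finite_on_diff (hV : IsAdmissible h V) (hSV : S ⊆ V)
    (hS : IsCompact S) (hconn : IsPreconnected S) (hU : IsOpen U) (hUS : U ⊆ S)
    (hne : (S \ U).Nonempty) (hfin : ∀ y ∈ S \ U, (germsAt h S y).Finite) (hx : x ∈ S) :
    (germsAt h S x).Finite := by
  have husc := upperSemicontinuous_germCount hV hSV hS.isClosed
  obtain ⟨y, hy, hmax⟩ := (husc.upperSemicontinuousOn _).exists_isMaxOn hne (hS.diff hU)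
  have hylt : germCount h S y < ⊤ := germCount_lt_top_iff.2 (hfin y hy)
  have hgt : ∀ z ∈ S, germCount h S y < germCount h S z → germCount h S y < germCount h U z :=
    fun z _ hz => by
      rwa [germCount, germCount, ← germsAt_eq_of_lt_germCount hV hSV hUS (fun _ hq => hmax hq) hz]
  have hcov := Order.covBy_succ_of_not_isMax (not_isMax_iff_ne_top.2 hylt.ne)
  have hle := forall_le_of_isPreconnected hconn hcov husc
    (lowerSemicontinuous_germCount hV (hUS.trans hSV) hU)
    (fun z _ => Set.encard_le_encard (germsAt_mono hUS z)) hgt ⟨y, hy.1, le_rfl⟩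
  exact germCount_lt_top_iff.1 ((hle x hx).trans_lt hylt)

end GermCount

section FiniteOrbits

theorem finite_germGroup_of_finite_on_sphere (hV : IsAdmissible h V) {r : ℝ} (hr : 0 ≤ r)
    (hrV : Metric.closedBall 0 r ⊆ V)
    (hfin : ∀ x ∈ Metric.sphere 0 r, (germsAt h (Metric.closedBall 0 r) x).Finite) :
    Finite (germGroup h) := by
  have h0 : (0 : Fin n → ℂ) ∈ Metric.closedBall 0 r := Metric.mem_closedBall_self hr
  rw [finite_germGroup_iff h0]
  rcases subsingleton_or_nontrivial (Fin n → ℂ) with hn | hn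
  · have : Subsingleton (Germ (𝓝 (0 : Fin n → ℂ)) (Fin n → ℂ)) := Quot.Subsingleton
    exact Set.toFinite _
  · rw [← Metric.closedBall_sdiff_ball] at hfin
    refine finite_germsAt_of_finite_on_diff hV hrV (isCompact_closedBall 0 r)
      (convex_closedBall 0 r).isPreconnected Metric.isOpen_ball Metric.ball_subset_closedBall ?_
      hfin h0
    rw [Metric.closedBall_sdiff_ball]
    exact NormedSpace.sphere_nonempty.2 hr

theorem exists_isIsolatedFixedPoint (hV : IsAdmissible h V)
    (hfix : FixedPointsIsolatedOrTrivial h V) (hSV : S ⊆ V) {V' : Set (Fin n → ℂ)}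
    (hSV' : S ⊆ V') (horbit : (orbit h V' x).Finite) (hinf : (germsAt h S x).Infinite) :
    ∃ w, IsIsolatedFixedPoint (wordMap h w) x := by
  rw [orbit_eq_image_germsAt] at horbit
  obtain ⟨_, ⟨u, hu, rfl⟩, _, ⟨v, hv, rfl⟩, hne, huv⟩ := hinf.exists_ne_map_eq_of_mapsTo
    (fun γ hγ => Set.mem_image_of_mem Germ.value (germsAt_mono hSV' x hγ)) horbit
  replace hu : Stays h V u x := Stays.mono hSV hu
  replace hv : Stays h V v x := Stays.mono hSV hv
  replace huv : wordMap h u x = wordMap h v x := huv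
  have hstays : Stays h V (u ++ FreeGroup.invRev v) x :=
    stays_append.2 ⟨hu, huv ▸ hv.invRev hV subset_rfl⟩
  have hfixed : wordMap h (u ++ FreeGroup.invRev v) x = x := by
    rw [wordMap_append, Function.comp_apply, huv, hv.wordMap_invRev hV]
  exact ⟨_, (hfix _ x (stays_iff_mem_wordDom.1 hstays).1 hfixed).resolve_right
    fun hid => hne (wordGerm_eq_of_append_invRev hV hu hv huv hid)⟩

theorem countable_setOf_isIsolatedFixedPoint (g : (Fin n → ℂ) → (Fin n → ℂ)) :
    {x | IsIsolatedFixedPoint g x}.Countable :=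
  countable_setOf_isolated {x | g x = x}

theorem finite_germGroup_of_hasFiniteOrbits (hV : IsAdmissible h V)
    (hfix : FixedPointsIsolatedOrTrivial h V) (horbits : HasFiniteOrbits h) :
    Finite (germGroup h) := by
  obtain ⟨V', hV', horbit⟩ := horbits
  obtain ⟨R, hR, hRV⟩ := Metric.mem_nhds_iff.1
    ((hV.1.inter hV'.1).mem_nhds ⟨hV.2.1, hV'.2.1⟩)
  have hcountable : (⋃ w, {x | IsIsolatedFixedPoint (wordMap h w) x}).Countable :=
    Set.countable_iUnion fun w => countable_setOf_isIsolatedFixedPoint _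
  obtain ⟨r, hr, hdisj⟩ := exists_disjoint_sphere_of_countable hcountable 0 hR
  obtain ⟨hrV, hrV'⟩ := Set.subset_inter_iff.1 ((Metric.closedBall_subset_ball hr.2).trans hRV)
  refine finite_germGroup_of_finite_on_sphere hV hr.1.le hrV fun x hx => ?_
  by_contra hinf
  have hxV' : x ∈ V' := hrV' (Metric.sphere_subset_closedBall hx)
  exact hdisj.notMem_of_mem_left hx
    (Set.mem_iUnion.2 (exists_isIsolatedFixedPoint hV hfix hrV hrV' (horbit x hxV') hinf))

theorem hasFiniteOrbits_of_finite_germGroup (hV : IsAdmissible h V)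
    (hfin : Finite (germGroup h)) : HasFiniteOrbits h := by
  obtain ⟨S, hS0, hS, hSV⟩ := exists_mem_nhds_isClosed_subset (hV.1.mem_nhds hV.2.1)
  have hlt : germCount h S 0 < ⊤ :=
    germCount_lt_top_iff.2 ((finite_germGroup_iff (mem_of_mem_nhds hS0)).1 hfin)
  obtain ⟨U, hUsub, hU, h0U⟩ := mem_nhds_iff.1
    (inter_mem hS0 (upperSemicontinuous_germCount hV hSV hS 0 ⊤ hlt))
  obtain ⟨hUS, hUlt⟩ := Set.subset_inter_iff.1 hUsub
  refine ⟨U, hV.mono (hUS.trans hSV) hU h0U, fun p hp => ?_⟩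
  rw [orbit_eq_image_germsAt]
  exact ((germCount_lt_top_iff.1 (hUlt hp)).subset (germsAt_mono hUS p)).image _

end FiniteOrbits

end LocalDynamics

end

theorem theoremA (n k : ℕ) (h : Fin k → LocalDynamics.LocalDiffeo n) (V : Set (Fin n → ℂ))
    (hV : LocalDynamics.IsAdmissible h V)
    (hfix : LocalDynamics.FixedPointsIsolatedOrTrivial h V) :
    LocalDynamics.HasFiniteOrbits h ↔ Finite (LocalDynamics.germGroup h) :=
  ⟨LocalDynamics.finite_germGroup_of_hasFiniteOrbits hV hfix,
    LocalDynamics.hasFiniteOrbits_of_finite_germGroup hV⟩
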